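/- Let $g\ge 1$ be an integer and let $f\in\mathbb{Z}[x]$ be a monic square-free polynomial of degree $2g+1$, so that $y^2=f(x)$ is an affine equation of a hyperelliptic curve of genus $g$ over $\mathbb{Q}$ with a rational Weierstrass point (elliptic curves being included). Let $\mathcal{W}=\operatorname{Spec}\,\mathbb{Z}[x,y]/(y^2-f(x))$ be the affine scheme over $\mathbb{Z}$ defined by this equation. For each $n\in\mathbb{Z}$ with $f(n)<0$, let $$T_n:\operatorname{Spec}\,\mathbb{Z}[\sqrt{f(n)}]\longrightarrow\mathcal{W}$$ be the closed immersion given by $x\mapsto n$, $y\mapsto\sqrt{f(n)}$, whose image is the closed subscheme $x=n$ of $\mathcal{W}$, and let $T_n^*:\operatorname{Pic}(\mathcal{W})\to\operatorname{Pic}(\mathbb{Z}[\sqrt{f(n)}])$ be the pullback of line bundles. Let $\mathcal{L}\in\operatorname{Pic}(\mathcal{W})$. 1. If $\mathcal{L}$ is non-trivial, then there are infinitely many integers $n<0$ with $f(n)<0$ such that $T_n^*\mathcal{L}$ is non-trivial. 2. If $\mathcal{L}$ has infinite order, then the order of $T_n^*\mathcal{L}$ in the (finite) group $\operatorname{Pic}(\mathbb{Z}[\sqrt{f(n)}])$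 is unbounded as $n\to-\infty$: for all $B\in\mathbb{N}$ and $N\in\mathbb{Z}$ there is an integer $n\le N$ with $n<0$ and $f(n)<0$ such that $T_n^*\mathcal{L}$ has finite order greater than $B$. -/

import Mathlib

open Polynomial

noncomputable section

namespace Hyperelliptic

/-- The coordinate ring `ℤ[x, y] / (y² - f(x))` of the affine scheme over `ℤ` defined by the
equation `y² = f(x)`; the inner variable of `ℤ[X][X]` is `x`, the outer one is `y`. The scheme
being affine, its line bundles are the invertible modules over this ring, so that its Picard
group is `CommRing.Pic (CoordRing f)`. -/
abbrev CoordRing (f : ℤ[X]) : Type :=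
  AdjoinRoot (X ^ 2 - C f : ℤ[X][X])

theorem eval₂_sqrtd (f : ℤ[X]) (n : ℤ) :
    (X ^ 2 - C f : ℤ[X][X]).eval₂
      ((Int.castRingHom (ℤ√(f.eval n))).comp (evalRingHom n)) Zsqrtd.sqrtd = 0 := by
  simp [pow_two, Zsqrtd.dmuld]

/-- The ring homomorphism `ℤ[x, y] / (y² - f(x)) → ℤ[√f(n)]`, `x ↦ n`, `y ↦ √f(n)`, which
corresponds to the closed immersion `T_n` of `Spec ℤ[√f(n)]` with image the locus `x = n`. -/
def specHom (f : ℤ[X]) (n : ℤ) : CoordRing f →+* ℤ√(f.eval n) :=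
  AdjoinRoot.lift ((Int.castRingHom (ℤ√(f.eval n))).comp (evalRingHom n)) Zsqrtd.sqrtd
    (eval₂_sqrtd f n)

theorem specHom_of (f : ℤ[X]) (n : ℤ) (p : ℤ[X]) :
    specHom f n (AdjoinRoot.of _ p) = ((p.eval n : ℤ) : ℤ√(f.eval n)) := by
  simp [specHom]

theorem specHom_root (f : ℤ[X]) (n : ℤ) :
    specHom f n (AdjoinRoot.root _) = Zsqrtd.sqrtd := by
  simp [specHom]

/-- The pullback of line bundles along `T_n`, that is, base change of invertible modules. -/
def pullback (f : ℤ[X]) (n : ℤ) :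
    CommRing.Pic (CoordRing f) →* CommRing.Pic (ℤ√(f.eval n)) :=
  CommRing.Pic.mapRingHom (specHom f n)

end Hyperelliptic

end

/-! The coordinate ring is `A = ℤ[x] ⊕ ℤ[x]y`, with norm form `N(u + vy) = u² - f v²` over `ℤ[x]`.
As `deg f` is odd, the two terms never cancel in leading degree, and since `f` is monic this
persists modulo every prime: `N` is anisotropic over `ℤ[x]` and over `𝔽_p[x]`. At an integer `n`
with `f(n) < 0`, on the other hand, `N` specialises to a positive definite form.

Represent the line bundle by an ideal `I` with `I J = (c)`, and let `d` be the gcd of the norms of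
its elements. If the pullback to `x = n` is trivial, some `t ∈ I` generates `I` modulo `x - n`; then
`(N(t)/d)(n)` divides a fixed nonzero integer (`eval_dvd_of_generates_mod`), so `N(t)(n)` is
`O(|d(n)|)`. Up to a fixed integer, `t` is a `ℤ[x]`-combination of a reduced pair `s₁, s₂` of `I`.
By definiteness and Cramer's rule, infinitely many such `n` force `deg N(s₁) ≤ deg d` or `deg N(s₂)
≤ deg d`, so `I` has an element of norm `a d` with `a` a nonzero integer
(`exists_norm_eq_const_mul`).

Anisotropy modulo `p` removes the primes of `a` (`exists_associated_norm`), and an element of `I`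
whose norm is associated to `d` generates `I` (`eq_span_singleton_of_norm_dvd`). Hence a bundle
trivial at infinitely many of these `n` is trivial. The unboundedness of orders follows by applying
this to the power `B!` of the bundle, the target Picard groups being finite. -/

open Polynomial

namespace Hyperelliptic

/-! ### Degrees of `u² - f v²` for `f` of odd degree. -/

section Degree

variable {R : Type*} [CommRing R] [IsDomain R] {f : R[X]}

theorem odd_natDegree_mul_sq (hf : Odd f.natDegree) {v : R[X]} (hv : v ≠ 0) :
    Odd (f * v ^ 2).natDegree := by
  have hf0 : f ≠ 0 := by rintro rfl; simp at hf
  rw [natDegree_mul hf0 (pow_ne_zero 2 hv), natDegree_pow]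
  exact hf.add_even (even_two_mul _)

theorem degree_sq_ne_degree_mul_sq (hf : Odd f.natDegree) {u v : R[X]} (h : u ≠ 0 ∨ v ≠ 0) :
    (u ^ 2).degree ≠ (f * v ^ 2).degree := by
  have hf0 : f ≠ 0 := by rintro rfl; simp at hf
  intro heq
  by_cases hv : v = 0
  · subst hv
    rw [zero_pow two_ne_zero, mul_zero, degree_zero, degree_eq_bot] at heq
    simp_all
  · have h2 := natDegree_eq_of_degree_eq heq
    have h3 := odd_natDegree_mul_sq hf hv
    rw [← h2, natDegree_pow] at h3
    exact (Nat.not_odd_iff_even.2 (even_two_mul _)) h3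

/-- The two terms of `u² - f v²` have degrees of distinct parity, so they do not cancel. -/
theorem degree_sq_sub_mul_sq (hf : Odd f.natDegree) (u v : R[X]) :
    (u ^ 2 - f * v ^ 2).degree = max (u ^ 2).degree (f * v ^ 2).degree := by
  by_cases h : u ≠ 0 ∨ v ≠ 0
  · rcases lt_or_gt_of_ne (degree_sq_ne_degree_mul_sq hf h) with h | h
    · rw [degree_sub_eq_right_of_degree_lt h, max_eq_right h.le]
    · rw [degree_sub_eq_left_of_degree_lt h, max_eq_left h.le]
  · push Not at h
    simp [h.1, h.2]

theorem eq_zero_of_sq_sub_mul_sq_eq_zero (hf : Odd f.natDegree) {u v : R[X]}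
    (h : u ^ 2 - f * v ^ 2 = 0) : u = 0 ∧ v = 0 := by
  by_contra! H
  refine degree_sq_ne_degree_mul_sq (u := u) (v := v) hf ?_ (by rw [sub_eq_zero.1 h])
  tauto

end Degree

/-! ### The norm form on the coordinate ring. -/

/-- The coordinate ring as a free module over `ℤ[x]` with basis `1, y`. -/
abbrev QuadRing (f : ℤ[X]) : Type := QuadraticAlgebra ℤ[X] f 0

namespace QuadRing

variable {f : ℤ[X]}

theorem norm_eq (z : QuadRing f) : z.norm = z.re ^ 2 - f * z.im ^ 2 := by
  rw [QuadraticAlgebra.norm_def]; ring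

theorem degree_norm (hf : Odd f.natDegree) (z : QuadRing f) :
    z.norm.degree = max (z.re ^ 2).degree (f * z.im ^ 2).degree := by
  rw [norm_eq, degree_sq_sub_mul_sq hf]

theorem norm_eq_zero (hf : Odd f.natDegree) {z : QuadRing f} : z.norm = 0 ↔ z = 0 := by
  refine ⟨fun h => ?_, fun h => by simp [h]⟩
  rw [norm_eq] at h
  exact QuadraticAlgebra.ext (eq_zero_of_sq_sub_mul_sq_eq_zero hf h).1
    (eq_zero_of_sq_sub_mul_sq_eq_zero hf h).2

theorem isDomain (hf : Odd f.natDegree) : IsDomain (QuadRing f) :=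
  have : NoZeroDivisors (QuadRing f) := ⟨fun {a b} h => by
    rw [← norm_eq_zero hf, ← norm_eq_zero hf, ← mul_eq_zero, ← map_mul, h,
      QuadraticAlgebra.norm_zero]⟩
  NoZeroDivisors.to_isDomain _

/-- The parity of the degree of the norm tells which of its two terms leads, so that elements of
equal parity can be reduced against each other by comparing a single coordinate. -/
theorem degree_norm_of_odd (hf : Odd f.natDegree) {z : QuadRing f} (hz : Odd z.norm.natDegree) :
    z.norm.degree = (f * z.im ^ 2).degree ∧ (z.re ^ 2).degree < (f * z.im ^ 2).degree := by
  have hmax := degree_norm hf z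
  rcases le_or_gt (f * z.im ^ 2).degree (z.re ^ 2).degree with h | h
  · rw [max_eq_left h] at hmax
    rw [natDegree_eq_of_degree_eq hmax, natDegree_pow] at hz
    exact absurd hz (Nat.not_odd_iff_even.2 (even_two_mul _))
  · exact ⟨by rw [hmax, max_eq_right h.le], h⟩

theorem degree_norm_of_even (hf : Odd f.natDegree) {z : QuadRing f} (hz0 : z ≠ 0)
    (hz : Even z.norm.natDegree) :
    z.norm.degree = (z.re ^ 2).degree ∧ (f * z.im ^ 2).degree < (z.re ^ 2).degree := by
  have hmax := degree_norm hf z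
  rcases le_or_gt (z.re ^ 2).degree (f * z.im ^ 2).degree with h | h
  · rw [max_eq_right h] at hmax
    by_cases hv : z.im = 0
    · rw [hv, zero_pow two_ne_zero, mul_zero, degree_zero, le_bot_iff, degree_eq_bot,
        pow_eq_zero_iff two_ne_zero] at h
      exact absurd (QuadraticAlgebra.ext h hv) hz0
    · rw [natDegree_eq_of_degree_eq hmax] at hz
      exact absurd hz (Nat.not_even_iff_odd.2 (odd_natDegree_mul_sq hf hv))
  · exact ⟨by rw [hmax, max_eq_left h.le], h⟩

/-- The fibre of the curve over each prime is integral, hence the norm is anisotropic modulo `p`. -/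
theorem dvd_of_dvd_norm (hm : f.Monic) (hf : Odd f.natDegree) {p : ℕ} (hp : p.Prime)
    {z : QuadRing f} (h : C (p : ℤ) ∣ z.norm) :
    algebraMap ℤ[X] (QuadRing f) (C (p : ℤ)) ∣ z := by
  have : Fact p.Prime := ⟨hp⟩
  have key : ∀ q : ℤ[X], C (p : ℤ) ∣ q ↔ q.map (Int.castRingHom (ZMod p)) = 0 := by
    intro q
    rw [C_dvd_iff_dvd_coeff, Polynomial.ext_iff]
    simp [ZMod.intCast_zmod_eq_zero_iff_dvd]
  rw [key, norm_eq] at h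
  simp only [Polynomial.map_sub, Polynomial.map_mul, Polynomial.map_pow] at h
  -- Reduction modulo `p` keeps the odd degree because `f` is monic.
  have := eq_zero_of_sq_sub_mul_sq_eq_zero (by rwa [hm.natDegree_map]) h
  rw [QuadraticAlgebra.algebraMap_dvd_iff, key, key]
  exact this

theorem norm_add (a b : QuadRing f) :
    (a + b).norm = a.norm + (2 * (a.re * b.re) - 2 * f * (a.im * b.im)) + b.norm := by
  simp only [norm_eq, QuadraticAlgebra.re_add, QuadraticAlgebra.im_add]; ring

theorem norm_smul (p : ℤ[X]) (a : QuadRing f) : (p • a).norm = p ^ 2 * a.norm := by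
  simp only [norm_eq, QuadraticAlgebra.re_smul, QuadraticAlgebra.im_smul, smul_eq_mul]; ring

/-! ### Reduction theory of ideals over `ℤ[x]`. -/

theorem degree_leadingCoeff_mul_sub_lt {u v : ℤ[X]} (hv : v ≠ 0) (hu : u ≠ 0)
    (h : v.natDegree ≤ u.natDegree) :
    (C v.leadingCoeff * u - C u.leadingCoeff * X ^ (u.natDegree - v.natDegree) * v).degree
      < u.degree := by
  have hv' : v.leadingCoeff ≠ 0 := leadingCoeff_ne_zero.2 hv
  have hu' : u.leadingCoeff ≠ 0 := leadingCoeff_ne_zero.2 hu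
  have e1 : (C v.leadingCoeff * u).degree = u.degree := by
    rw [degree_mul, degree_C hv', zero_add]
  have e2 : (C u.leadingCoeff * X ^ (u.natDegree - v.natDegree) * v).degree = u.degree := by
    rw [degree_mul, degree_C_mul_X_pow _ hu', degree_eq_natDegree hv, degree_eq_natDegree hu]
    norm_cast
    omega
  rw [← e1]
  refine degree_sub_lt_left (by rw [e1, e2]) (by simp [hv, hu]) ?_
  rw [leadingCoeff_mul, leadingCoeff_mul, leadingCoeff_C_mul_X_pow, leadingCoeff_C, mul_comm]

theorem degree_mul_sq_lt {g a b : ℤ[X]} (hg : g ≠ 0) (h : a.degree < b.degree) :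
    (g * a ^ 2).degree < (g * b ^ 2).degree := by
  have hb : b ≠ 0 := by rintro rfl; simp at h
  by_cases ha : a = 0
  · rw [ha, zero_pow two_ne_zero, mul_zero, degree_zero, bot_lt_iff_ne_bot, ne_eq, degree_eq_bot]
    exact mul_ne_zero hg (pow_ne_zero 2 hb)
  · rw [degree_mul, degree_mul, degree_pow, degree_pow]
    rw [degree_eq_natDegree ha, degree_eq_natDegree hb] at *
    rw [degree_eq_natDegree hg, nsmul_eq_mul, nsmul_eq_mul]
    norm_cast at *
    omega

theorem degree_mul_sub_sq_lt {g a b : ℤ[X]} {n : WithBot ℕ}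
    (ha : (g * a ^ 2).degree < n) (hb : (g * b ^ 2).degree < n) :
    (g * (a - b) ^ 2).degree < n := by
  have key : ∀ c : ℤ[X], (a - b).degree ≤ c.degree → (g * c ^ 2).degree < n →
      (g * (a - b) ^ 2).degree < n := fun c hc h => by
    refine lt_of_le_of_lt ?_ h
    rw [degree_mul, degree_mul, degree_pow, degree_pow]
    gcongr
  rcases le_total a.degree b.degree with h | h
  · exact key b ((degree_sub_le a b).trans (max_le h le_rfl)) hb
  · exact key a ((degree_sub_le a b).trans (max_le le_rfl h)) ha

theorem degree_mul_mul_sq_lt {g u r v : ℤ[X]} (hr : r ≠ 0) (h : (g * v ^ 2).degree < u.degree) :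
    (g * (r * v) ^ 2).degree < (r ^ 2 * u).degree := by
  rw [show g * (r * v) ^ 2 = r ^ 2 * (g * v ^ 2) by ring, degree_mul, degree_mul (p := r ^ 2)]
  exact WithBot.add_lt_add_left (by rw [ne_eq, degree_eq_bot]; exact pow_ne_zero 2 hr) h

/-- Division step for two elements whose norms have degrees of the same parity. -/
theorem exists_degree_norm_lt (hf : Odd f.natDegree) {a s : QuadRing f} (ha : a ≠ 0) (hs : s ≠ 0)
    (hpar : Even a.norm.natDegree ↔ Even s.norm.natDegree)
    (hle : s.norm.natDegree ≤ a.norm.natDegree) :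
    ∃ (c : ℤ) (r : ℤ[X]), c ≠ 0 ∧ (C c • a - r • s).norm.degree < a.norm.degree := by
  have hf0 : f ≠ 0 := by rintro rfl; simp at hf
  by_cases he : Even a.norm.natDegree
  · obtain ⟨ha1, ha2⟩ := degree_norm_of_even hf ha he
    obtain ⟨hs1, hs2⟩ := degree_norm_of_even hf hs (hpar.1 he)
    have hau : a.re ≠ 0 := by intro h; simp [h] at ha2
    have hsu : s.re ≠ 0 := by intro h; simp [h] at hs2
    rw [natDegree_eq_of_degree_eq ha1, natDegree_eq_of_degree_eq hs1, natDegree_pow,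
      natDegree_pow] at hle
    have hle' : s.re.natDegree ≤ a.re.natDegree := by omega
    have hr0 : C a.re.leadingCoeff * X ^ (a.re.natDegree - s.re.natDegree) ≠ 0 :=
      mul_ne_zero (by simpa) (by simp)
    -- Pseudo-division: `a` is scaled by the leading coefficient of the dominant coordinate of `s`,
    -- since one cannot divide by it in `ℤ`.
    refine ⟨s.re.leadingCoeff, C a.re.leadingCoeff * X ^ (a.re.natDegree - s.re.natDegree),
      by simpa, ?_⟩
    rw [degree_norm hf, ha1, max_lt_iff]
    simp only [QuadraticAlgebra.re_sub, QuadraticAlgebra.im_sub, QuadraticAlgebra.re_smul,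
      QuadraticAlgebra.im_smul, smul_eq_mul]
    constructor
    · simpa using degree_mul_sq_lt one_ne_zero (degree_leadingCoeff_mul_sub_lt hsu hau hle')
    · refine degree_mul_sub_sq_lt ?_ ?_
      · refine (degree_mul_mul_sq_lt (by simpa) ha2).trans_eq ?_
        rw [degree_mul, degree_pow, degree_C (by simpa)]
        simp
      · refine (degree_mul_mul_sq_lt hr0 hs2).trans_eq ?_
        rw [← mul_pow, degree_pow, degree_pow, degree_mul, degree_C_mul_X_pow _ (by simpa),
          degree_eq_natDegree hau, degree_eq_natDegree hsu]
        norm_cast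
        congr 2
        omega
  · obtain ⟨ha1, ha2⟩ := degree_norm_of_odd hf (Nat.not_even_iff_odd.1 he)
    obtain ⟨hs1, hs2⟩ := degree_norm_of_odd hf (Nat.not_even_iff_odd.1 (mt hpar.2 he))
    have hau : a.im ≠ 0 := by intro h; simp [h] at ha2
    have hsu : s.im ≠ 0 := by intro h; simp [h] at hs2
    rw [natDegree_eq_of_degree_eq ha1, natDegree_eq_of_degree_eq hs1, natDegree_mul hf0
      (pow_ne_zero _ hsu), natDegree_mul hf0 (pow_ne_zero _ hau), natDegree_pow,
      natDegree_pow] at hle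
    have hle' : s.im.natDegree ≤ a.im.natDegree := by omega
    have hr0 : C a.im.leadingCoeff * X ^ (a.im.natDegree - s.im.natDegree) ≠ 0 :=
      mul_ne_zero (by simpa) (by simp)
    refine ⟨s.im.leadingCoeff, C a.im.leadingCoeff * X ^ (a.im.natDegree - s.im.natDegree),
      by simpa, ?_⟩
    rw [degree_norm hf, ha1, max_lt_iff]
    simp only [QuadraticAlgebra.re_sub, QuadraticAlgebra.im_sub, QuadraticAlgebra.re_smul,
      QuadraticAlgebra.im_smul, smul_eq_mul]
    constructor
    · rw [← one_mul ((_ - _) ^ 2)]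
      refine degree_mul_sub_sq_lt ?_ ?_
      · refine (degree_mul_mul_sq_lt (by simpa) ((one_mul (a.re ^ 2)).symm ▸ ha2)).trans_eq ?_
        rw [degree_mul, degree_pow, degree_C (by simpa)]
        simp
      · refine (degree_mul_mul_sq_lt hr0 ((one_mul (s.re ^ 2)).symm ▸ hs2)).trans_eq ?_
        rw [mul_left_comm, ← mul_pow, degree_mul, degree_mul, degree_pow, degree_pow, degree_mul,
          degree_C_mul_X_pow _ (by simpa), degree_eq_natDegree hau, degree_eq_natDegree hsu]
        norm_cast
        congr 3
        omega
    · exact degree_mul_sq_lt hf0 (degree_leadingCoeff_mul_sub_lt hsu hau hle')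

theorem norm_omega : (QuadraticAlgebra.omega : QuadRing f).norm = -f := by
  simp [norm_eq]

theorem exists_min_natDegree_norm {P : QuadRing f → Prop} (h : ∃ a, P a) :
    ∃ s, P s ∧ ∀ a, P a → s.norm.natDegree ≤ a.norm.natDegree := by
  obtain ⟨s, hs, hmin⟩ := (measure fun a : QuadRing f => a.norm.natDegree).wf.has_min {a | P a} h
  exact ⟨s, hs, fun a ha => not_lt.1 (hmin a ha)⟩

/-- Elements of minimal norm degree of either parity span an ideal over `ℤ[x]`, up to integers. -/
theorem exists_reduced_pair (hf : Odd f.natDegree) {I : Ideal (QuadRing f)} (hI : I ≠ ⊥) :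
    ∃ s₁ ∈ I, ∃ s₂ ∈ I, s₁ ≠ 0 ∧ s₂ ≠ 0 ∧ Even s₁.norm.natDegree ∧ Odd s₂.norm.natDegree ∧
      ∀ a ∈ I, ∃ (D : ℤ) (p q : ℤ[X]), D ≠ 0 ∧ C D • a = p • s₁ + q • s₂ := by
  have := isDomain hf
  have hf0 : f ≠ 0 := by rintro rfl; simp at hf
  obtain ⟨b, hb, hb0⟩ := (Submodule.ne_bot_iff I).1 hI
  have hω : (QuadraticAlgebra.omega : QuadRing f) ≠ 0 := by
    rw [ne_eq, ← norm_eq_zero hf, norm_omega]; simpa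
  -- Multiplication by `y` shifts the degree of the norm by the odd number `deg f`, so both parities
  -- occur in `I`.
  have hpar : (QuadraticAlgebra.omega * b).norm.natDegree = f.natDegree + b.norm.natDegree := by
    rw [map_mul, norm_omega, natDegree_mul (by simpa) ((norm_eq_zero hf).not.2 hb0), natDegree_neg]
  have hωb : QuadraticAlgebra.omega * b ∈ I := I.mul_mem_left _ hb
  have hωb0 : QuadraticAlgebra.omega * b ≠ 0 := mul_ne_zero hω hb0
  obtain ⟨s₁, ⟨h₁I, h₁0, h₁⟩, h₁min⟩ := exists_min_natDegree_norm
    (P := fun a : QuadRing f => a ∈ I ∧ a ≠ 0 ∧ Even a.norm.natDegree) (by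
      by_cases he : Even b.norm.natDegree
      · exact ⟨b, hb, hb0, he⟩
      · refine ⟨_, hωb, hωb0, ?_⟩
        rw [hpar]
        exact hf.add_odd (Nat.not_even_iff_odd.1 he))
  obtain ⟨s₂, ⟨h₂I, h₂0, h₂⟩, h₂min⟩ := exists_min_natDegree_norm
    (P := fun a : QuadRing f => a ∈ I ∧ a ≠ 0 ∧ Odd a.norm.natDegree) (by
      by_cases he : Even b.norm.natDegree
      · refine ⟨_, hωb, hωb0, ?_⟩
        rw [hpar]
        exact hf.add_even he
      · exact ⟨b, hb, hb0, Nat.not_even_iff_odd.1 he⟩)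
  refine ⟨s₁, h₁I, s₂, h₂I, h₁0, h₂0, h₁, h₂, fun a => ?_⟩
  induction hn : a.norm.natDegree using Nat.strong_induction_on generalizing a with
  | _ n ih =>
    intro haI
    by_cases ha0 : a = 0
    · exact ⟨1, 0, 0, one_ne_zero, by simp [ha0]⟩
    have step : ∀ (c : ℤ) (b : QuadRing f), b ∈ I → b.norm.degree < a.norm.degree → c ≠ 0 →
        (∃ p q : ℤ[X], C c • a - b = p • s₁ + q • s₂) →
        ∃ (D : ℤ) (p q : ℤ[X]), D ≠ 0 ∧ C D • a = p • s₁ + q • s₂ := by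
      rintro c b hbI hlt hc ⟨p, q, hpq⟩
      by_cases hb0 : b = 0
      · exact ⟨c, p, q, hc, by rw [← hpq, hb0, sub_zero]⟩
      · obtain ⟨D, p', q', hD, h⟩ := ih _ (hn ▸ natDegree_lt_natDegree
          ((norm_eq_zero hf).not.2 hb0) hlt) b rfl hbI
        refine ⟨D * c, C D * p + p', C D * q + q', mul_ne_zero hD hc, ?_⟩
        rw [C_mul, mul_smul, ← sub_add_cancel (C c • a) b, smul_add, hpq, h]
        simp only [smul_add, mul_smul, add_smul]
        abel
    have hsub : ∀ (c : ℤ) (r : ℤ[X]) (s : QuadRing f), s ∈ I → C c • a - r • s ∈ I :=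
      fun c r s hs => I.sub_mem (Submodule.smul_of_tower_mem I _ haI)
        (Submodule.smul_of_tower_mem I _ hs)
    by_cases he : Even a.norm.natDegree
    · obtain ⟨c, r, hc, hlt⟩ := exists_degree_norm_lt hf ha0 h₁0 (by simp [he, h₁])
        (h₁min a ⟨haI, ha0, he⟩)
      exact step c _ (hsub c r _ h₁I) hlt hc ⟨r, 0, by simp⟩
    · have ho := Nat.not_even_iff_odd.1 he
      obtain ⟨c, r, hc, hlt⟩ := exists_degree_norm_lt hf ha0 h₂0
        (by simp [he, Nat.not_even_iff_odd.2 h₂]) (h₂min a ⟨haI, ha0, ho⟩)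
      exact step c _ (hsub c r _ h₂I) hlt hc ⟨0, r, by simp⟩

/-- A common denominator for a finitely generated module of fractions. -/
theorem exists_common_multiplier (I : Ideal (QuadRing f)) (P : Submodule ℤ[X] (QuadRing f))
    (h : ∀ a ∈ I, ∃ D : ℤ, D ≠ 0 ∧ C D • a ∈ P) :
    ∃ D : ℤ, D ≠ 0 ∧ ∀ a ∈ I, C D • a ∈ P := by
  obtain ⟨S, hS⟩ := (isNoetherian_def.1 (inferInstance : IsNoetherian ℤ[X] (QuadRing f)))
    (I.restrictScalars ℤ[X])
  have hSI : ∀ a ∈ S, a ∈ I := fun a ha => by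
    have : a ∈ I.restrictScalars ℤ[X] := hS ▸ Submodule.subset_span ha
    simpa using this
  choose! D hD hDP using h
  refine ⟨∏ a ∈ S, D a, Finset.prod_ne_zero_iff.2 fun a ha => hD a (hSI a ha), fun a ha => ?_⟩
  have ha' : a ∈ Submodule.span ℤ[X] (S : Set (QuadRing f)) := hS ▸ (by simpa using ha)
  clear ha
  induction ha' using Submodule.span_induction with
  | mem x hx =>
    rw [← Finset.prod_erase_mul _ _ hx, C_mul, mul_smul]
    exact P.smul_mem _ (hDP x (hSI x hx))
  | zero => simp
  | add x y _ _ hx hy =>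
    rw [smul_add]
    exact P.add_mem hx hy
  | smul r x _ hx =>
    rw [smul_comm]
    exact P.smul_mem _ hx

/-- Greatest common divisor of an ideal of `ℤ[x]`, which lies in the ideal up to an integer. -/
theorem exists_gcd (n : Ideal ℤ[X]) (hn : n ≠ ⊥) :
    ∃ d : ℤ[X], (∀ e b, (∀ x ∈ n, e ∣ x * b) ↔ e ∣ d * b) ∧ ∃ D : ℤ, D ≠ 0 ∧ C D * d ∈ n := by
  obtain ⟨S, rfl⟩ := (isNoetherianRing_iff_ideal_fg ℤ[X]).1 inferInstance n
  let : NormalizedGCDMonoid ℤ[X] := Classical.choice inferInstance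
  have hd : ∀ e b, (∀ x ∈ Ideal.span (S : Set ℤ[X]), e ∣ x * b) ↔ e ∣ S.gcd id * b := by
    intro e b
    have h1 : e ∣ S.gcd id * b ↔ ∀ x ∈ S, e ∣ x * b := by
      rw [← (Finset.gcd_mul_right' S id b).dvd_iff_dvd_right, Finset.dvd_gcd_iff]
      rfl
    rw [h1]
    refine ⟨fun h x hx => h x (Ideal.subset_span hx), fun h x hx => ?_⟩
    induction hx using Submodule.span_induction with
    | mem x hx => exact h x hx
    | zero => simp
    | add x y _ _ hx hy => rw [add_mul]; exact dvd_add hx hy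
    | smul r x _ hx => rw [smul_eq_mul, mul_assoc]; exact hx.mul_left r
  refine ⟨S.gcd id, hd, ?_⟩
  set n := Ideal.span (S : Set ℤ[X])
  let := Polynomial.algebra ℤ ℚ
  have : IsLocalization ((nonZeroDivisors ℤ).map (C : ℤ →+* ℤ[X])) ℚ[X] :=
    Polynomial.isLocalization _ _
  -- Over `ℚ[x]` the ideal is principal. Clearing denominators in a generator gives `x ∈ n` whose
  -- primitive part divides all of `n` by Gauss's lemma, hence divides the gcd; the content of `x`
  -- is then the required integer.
  obtain ⟨h, hh⟩ := IsPrincipalIdealRing.principal (n.map (algebraMap ℤ[X] ℚ[X]))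
  have hmem : h ∈ n.map (algebraMap ℤ[X] ℚ[X]) := hh ▸ Ideal.mem_span_singleton_self h
  rw [IsLocalization.mem_map_algebraMap_iff
    ((nonZeroDivisors ℤ).map (C : ℤ →+* ℤ[X])) ℚ[X]] at hmem
  obtain ⟨⟨⟨x, hx⟩, ⟨_, m, hm, rfl⟩⟩, hxm⟩ := hmem
  have hxh : (x.map (algebraMap ℤ ℚ)) = h * C (m : ℚ) := by simpa using hxm.symm
  have hm0 : m ≠ 0 := nonZeroDivisors.ne_zero hm
  have hprim : ∀ z ∈ n, x.primPart ∣ z := fun z hz => by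
    refine (isPrimitive_primPart x).dvd_of_fraction_map_dvd_fraction_map (K := ℚ) ?_
    have h1 : h ∣ z.map (algebraMap ℤ ℚ) := by
      rw [← Ideal.mem_span_singleton, ← Ideal.submodule_span_eq, ← hh]
      exact Ideal.mem_map_of_mem _ hz
    refine dvd_trans ?_ h1
    have h2 : x.primPart.map (algebraMap ℤ ℚ) ∣ x.map (algebraMap ℤ ℚ) :=
      map_dvd (mapRingHom (algebraMap ℤ ℚ)) (primPart_dvd x)
    rw [hxh] at h2
    exact (IsUnit.dvd_mul_right (isUnit_C.2 (by simpa using hm0))).1 h2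
  have hx0 : x ≠ 0 := by
    rintro rfl
    have h0 : h = 0 := by
      rw [Polynomial.map_zero] at hxh
      exact (mul_eq_zero.1 hxh.symm).resolve_right (by simpa)
    obtain ⟨z, hz, hz0⟩ := (Submodule.ne_bot_iff n).1 hn
    have h1 : z.map (algebraMap ℤ ℚ) ∈ Ideal.span {h} := by
      rw [← Ideal.submodule_span_eq, ← hh]
      exact Ideal.mem_map_of_mem _ hz
    rw [h0, Ideal.mem_span_singleton, zero_dvd_iff,
      Polynomial.map_eq_zero_iff (algebraMap ℤ ℚ).injective_int] at h1
    exact hz0 h1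
  obtain ⟨e, he⟩ : x.primPart ∣ S.gcd id := by
    simpa using (hd x.primPart 1).1 (by simpa using hprim)
  refine ⟨x.content, by rwa [ne_eq, content_eq_zero_iff], ?_⟩
  rw [he, ← mul_assoc, ← eq_C_content_mul_primPart]
  exact n.mul_mem_right _ hx

/-! ### Elements of smallest possible norm generate an invertible ideal. -/

theorem norm_mul (a b : QuadRing f) : (a * b).norm = a.norm * b.norm :=
  QuadraticAlgebra.norm.map_mul a b

/-- This is the characteristic equation of `a / s` cleared of denominators: the middle coefficient
is the trace of `a * star s`, written as the polarisation of the norm. -/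
theorem sq_mul_sub_eq_zero (a s : QuadRing f) :
    algebraMap ℤ[X] _ s.norm * a ^ 2 -
      algebraMap ℤ[X] _ ((a + s).norm - a.norm - s.norm) * (a * s) +
      algebraMap ℤ[X] _ a.norm * s ^ 2 = 0 := by
  simp only [map_sub, QuadraticAlgebra.algebraMap_norm_eq_mul_star, star_add]
  ring

/-- If every quotient `a / s` with `a ∈ I` is integral of degree two, then the invertible ideal `I`
is generated by `s`, as a proper ideal stays proper in the integral closure. -/
theorem eq_span_singleton_of_integral {R : Type*} (F : Type*) [CommRing R] [IsDomain R] [Field F]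
    [Algebra R F] [IsFractionRing R F] {I J : Ideal R} {c s : R} (hc : c ≠ 0)
    (hIJ : I * J = Ideal.span {c}) (hs : s ∈ I) (hs0 : s ≠ 0)
    (hquad : ∀ a ∈ I, ∃ T M : R, a ^ 2 - T * (a * s) + M * s ^ 2 = 0) : I = Ideal.span {s} := by
  let O := integralClosure R F
  have hsF : algebraMap R F s ≠ 0 := by simpa using hs0
  have hcF : algebraMap R F c ≠ 0 := by simpa using hc
  have hint : ∀ a ∈ I, IsIntegral R (algebraMap R F a / algebraMap R F s) := by
    intro a ha
    obtain ⟨T, M, key⟩ := hquad a ha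
    refine ⟨X ^ 2 - C T * X + C M, ?_, ?_⟩
    · rw [sub_add]
      refine monic_X_pow_sub ?_
      compute_degree!
    · have := congrArg (algebraMap R F) key
      simp only [map_add, map_sub, map_mul, map_pow, map_zero] at this
      simp only [eval₂_add, eval₂_sub, eval₂_mul, eval₂_X_pow, eval₂_C, eval₂_X]
      field_simp
      linear_combination this
  have hmem : ∀ a ∈ I, ∀ b ∈ J, ∃ x, a * b = c * x := fun a ha b hb => by
    have : a * b ∈ Ideal.span {c} := hIJ ▸ Ideal.mul_mem_mul ha hb
    exact Ideal.mem_span_singleton.1 this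
  -- `K` is the ideal `(s / c) J`, the inverse of `s⁻¹ I`; the claim amounts to `1 ∈ K`.
  let K : Ideal R :=
    { carrier := {x | ∃ b ∈ J, s * b = c * x}
      add_mem' := by
        rintro x y ⟨b, hb, h⟩ ⟨b', hb', h'⟩
        exact ⟨b + b', J.add_mem hb hb', by rw [mul_add, h, h', mul_add]⟩
      zero_mem' := ⟨0, J.zero_mem, by simp⟩
      smul_mem' := by
        rintro r x ⟨b, hb, h⟩
        exact ⟨r * b, J.mul_mem_left r hb, by rw [smul_eq_mul, mul_left_comm, h, mul_left_comm]⟩ }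
  have hK : K = ⊤ := by
    rw [← Ideal.map_eq_top_iff (algebraMap R O)
      (FaithfulSMul.algebraMap_injective _ _) (algebraMap_isIntegral_iff.2 inferInstance)]
    -- In the integral closure, `a b / c = (a / s) (s b / c)` with `a / s` integral; writing `c` as
    -- a sum of products `a b` puts `1` in the extension of `K`.
    have hfrac : ∀ x ∈ I * J, ∃ y ∈ K.map (algebraMap R O),
        (y : F) = algebraMap R F x / algebraMap R F c := by
      intro x hx
      induction hx using Submodule.mul_induction_on' with
      | mem_mul_mem a ha b hb =>
        obtain ⟨x, hx⟩ := hmem s hs b hb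
        refine ⟨⟨_, hint a ha⟩ * algebraMap _ O x,
          Ideal.mul_mem_left _ _ (Ideal.mem_map_of_mem _ ⟨b, hb, hx⟩), ?_⟩
        have := congrArg (algebraMap R F) hx
        simp only [map_mul] at this
        have hO : ((algebraMap R O x : O) : F) = algebraMap R F x := rfl
        rw [MulMemClass.coe_mul, hO, map_mul]
        field_simp
        linear_combination (-algebraMap R F a) * this
      | add x _ y _ hx hy =>
        obtain ⟨u, hu, hu'⟩ := hx
        obtain ⟨v, hv, hv'⟩ := hy
        exact ⟨u + v, Ideal.add_mem _ hu hv, by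
          rw [AddMemClass.coe_add, hu', hv', map_add, add_div]⟩
    obtain ⟨y, hy, hyc⟩ := hfrac c (hIJ ▸ Ideal.mem_span_singleton_self c)
    rw [div_self hcF] at hyc
    rw [Ideal.eq_top_iff_one]
    rwa [show (1 : O) = y from Subtype.ext hyc.symm]
  obtain ⟨b, hb, hsb⟩ : (1 : R) ∈ K := hK ▸ Submodule.mem_top
  rw [mul_one] at hsb
  have hb0 : b ≠ 0 := by rintro rfl; exact hc (by rw [← hsb, mul_zero])
  refine le_antisymm (fun a ha => ?_) ((Ideal.span_singleton_le_iff_mem I).2 hs)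
  obtain ⟨x, hx⟩ := hmem a ha b hb
  rw [Ideal.mem_span_singleton]
  refine ⟨x, mul_right_cancel₀ hb0 ?_⟩
  rw [hx, ← hsb]; ring

theorem eq_span_singleton_of_norm_dvd (hf : Odd f.natDegree) {I J : Ideal (QuadRing f)}
    {c s : QuadRing f} (hc : c ≠ 0) (hIJ : I * J = Ideal.span {c}) (hs : s ∈ I) (hs0 : s ≠ 0)
    (hdvd : ∀ a ∈ I, s.norm ∣ a.norm) : I = Ideal.span {s} := by
  have := isDomain hf
  refine eq_span_singleton_of_integral (FractionRing (QuadRing f)) hc hIJ hs hs0 fun a ha => ?_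
  obtain ⟨T, hT⟩ : s.norm ∣ (a + s).norm - a.norm - s.norm :=
    dvd_sub (dvd_sub (hdvd _ (I.add_mem ha hs)) (hdvd _ ha)) dvd_rfl
  obtain ⟨M, hM⟩ := hdvd a ha
  have key := sq_mul_sub_eq_zero a s
  rw [hT, hM, RingHom.map_mul, RingHom.map_mul] at key
  have hs' : algebraMap ℤ[X] (QuadRing f) s.norm ≠ 0 := by
    rw [ne_eq, map_eq_zero_iff _ QuadraticAlgebra.algebraMap_injective, norm_eq_zero hf]
    exact hs0
  exact ⟨algebraMap ℤ[X] _ T, algebraMap ℤ[X] _ M,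
    mul_left_cancel₀ hs' (by linear_combination key)⟩

/-- A greatest common divisor of the norms of elements of `I`, stably under multiplication. -/
def IsNormGCD (I : Ideal (QuadRing f)) (d : ℤ[X]) : Prop :=
  ∀ e b, (∀ a ∈ I, e ∣ a.norm * b) ↔ e ∣ d * b

theorem IsNormGCD.dvd_norm {I : Ideal (QuadRing f)} {d : ℤ[X]} (h : IsNormGCD I d)
    {a : QuadRing f} (ha : a ∈ I) : d ∣ a.norm := by
  simpa using (h d 1).2 (by simp) a ha

theorem exists_isNormGCD (hf : Odd f.natDegree) {I : Ideal (QuadRing f)} (hI : I ≠ ⊥) :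
    ∃ d, IsNormGCD I d ∧
      ∃ D : ℤ, D ≠ 0 ∧ C D * d ∈ Ideal.span (QuadraticAlgebra.norm '' (I : Set (QuadRing f))) := by
  obtain ⟨b, hb, hb0⟩ := (Submodule.ne_bot_iff I).1 hI
  obtain ⟨d, hd, hD⟩ := exists_gcd (Ideal.span (QuadraticAlgebra.norm '' (I : Set (QuadRing f))))
    ((Submodule.ne_bot_iff _).2 ⟨b.norm, Ideal.subset_span ⟨b, hb, rfl⟩,
      (norm_eq_zero hf).not.2 hb0⟩)
  refine ⟨d, fun e b => ?_, hD⟩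
  rw [← hd]
  refine ⟨fun h x hx => ?_, fun h a ha => h _ (Ideal.subset_span ⟨a, ha, rfl⟩)⟩
  induction hx using Submodule.span_induction with
  | mem x hx => obtain ⟨a, ha, rfl⟩ := hx; exact h a ha
  | zero => simp
  | add x y _ _ hx hy => rw [add_mul]; exact dvd_add hx hy
  | smul r x _ hx => rw [smul_eq_mul, mul_assoc]; exact hx.mul_left r

/-- If the norm of `s ∈ I` is divisible by `p` times the norm of the invertible ideal `I`, then
`s ∈ p I`. -/
theorem exists_eq_smul_of_dvd_norm (hm : f.Monic) (hf : Odd f.natDegree)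
    {I J : Ideal (QuadRing f)} {c s : QuadRing f} (hc : c ≠ 0) (hIJ : I * J = Ideal.span {c})
    {d : ℤ[X]} (hd : IsNormGCD I d) (hd0 : d ≠ 0) (hs : s ∈ I) {p : ℕ} (hp : p.Prime)
    (hdvd : C (p : ℤ) * d ∣ s.norm) : ∃ s' ∈ I, s = C (p : ℤ) • s' := by
  have := isDomain hf
  have hmem : ∀ a ∈ I, ∀ b ∈ J, c ∣ a * b := fun a ha b hb => by
    have : a * b ∈ Ideal.span {c} := hIJ ▸ Ideal.mul_mem_mul ha hb
    exact Ideal.mem_span_singleton.1 this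
  have hstep : ∀ b ∈ J, ∃ x, s * b = c * (C (p : ℤ) • x) := by
    intro b hb
    obtain ⟨x, hx⟩ := hmem s hs b hb
    by_cases hb0 : b = 0
    · exact ⟨0, by simp [hb0]⟩
    -- Here the multiplier in `IsNormGCD` is needed: `N(c)` divides `N(a) N(b)` for every `a ∈ I`,
    -- with `b` fixed.
    have h1 : c.norm ∣ d * b.norm := (hd _ _).1 fun a ha => by
      obtain ⟨y, hy⟩ := hmem a ha b hb
      exact ⟨y.norm, by rw [← norm_mul, hy, norm_mul]⟩
    have h2 : C (p : ℤ) ∣ x.norm := by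
      have h3 : C (p : ℤ) * (d * b.norm) ∣ x.norm * (d * b.norm) := by
        rw [← mul_assoc]
        refine (mul_dvd_mul_right hdvd _).trans ?_
        rw [← norm_mul, hx, norm_mul, mul_comm]
        exact mul_dvd_mul_left _ h1
      exact (mul_dvd_mul_iff_right (mul_ne_zero hd0 ((norm_eq_zero hf).not.2 hb0))).1 h3
    obtain ⟨y, hy⟩ := dvd_of_dvd_norm hm hf hp h2
    exact ⟨y, by rw [hx, hy, Algebra.smul_def]⟩
  have hall : ∀ x ∈ I * J, ∃ y ∈ I, s * x = c * (C (p : ℤ) • y) := by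
    intro x hx
    induction hx using Submodule.mul_induction_on' with
    | mem_mul_mem a ha b hb =>
      obtain ⟨x, hx⟩ := hstep b hb
      refine ⟨x * a, I.mul_mem_left _ ha, ?_⟩
      rw [mul_left_comm, hx, ← smul_mul_assoc]; ring
    | add x _ y _ hx hy =>
      obtain ⟨u, hu, hu'⟩ := hx
      obtain ⟨v, hv, hv'⟩ := hy
      exact ⟨u + v, I.add_mem hu hv, by rw [mul_add, hu', hv', smul_add, mul_add]⟩
  obtain ⟨y, hy, h⟩ := hall c (hIJ ▸ Ideal.mem_span_singleton_self c)
  exact ⟨y, hy, mul_left_cancel₀ hc (by rw [← h, mul_comm])⟩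

/-- Descent on `|a|`: for a prime `p ∣ a`, `s` is `p` times an element of `I`, and dividing by `p`
divides the norm by `p²`, leaving an integer multiple of `d` again. -/
theorem exists_associated_norm (hm : f.Monic) (hf : Odd f.natDegree)
    {I J : Ideal (QuadRing f)} {c s : QuadRing f} (hc : c ≠ 0) (hIJ : I * J = Ideal.span {c})
    {d : ℤ[X]} (hd : IsNormGCD I d) (hd0 : d ≠ 0) (hs : s ∈ I) {a : ℤ} (ha : a ≠ 0)
    (hsa : s.norm = C a * d) : ∃ s' ∈ I, Associated s'.norm d := by
  induction hn : a.natAbs using Nat.strong_induction_on generalizing a s with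
  | _ n ih =>
    by_cases h1 : a.natAbs = 1
    · refine ⟨s, hs, ?_⟩
      rw [hsa]
      exact associated_unit_mul_left d _ (isUnit_C.2 (Int.isUnit_iff_natAbs_eq.2 h1))
    obtain ⟨p, hp, hpa⟩ := Nat.exists_prime_and_dvd h1
    obtain ⟨a', rfl⟩ : (p : ℤ) ∣ a := Int.natCast_dvd.2 hpa
    obtain ⟨s', hs', rfl⟩ := exists_eq_smul_of_dvd_norm hm hf hc hIJ hd hd0 hs hp
      ⟨C a', by rw [hsa, C_mul]; ring⟩
    obtain ⟨b, hb⟩ := hd.dvd_norm hs'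
    have hp0 : (C (p : ℤ) : ℤ[X]) ≠ 0 := by simpa using hp.ne_zero
    have h2 : C a' = C (p : ℤ) * b := by
      rw [norm_smul, hb, C_mul] at hsa
      refine mul_left_cancel₀ hp0 (mul_right_cancel₀ hd0 ?_)
      linear_combination -hsa
    obtain ⟨b', rfl⟩ : ∃ b', b = C b' := by
      refine ⟨b.coeff 0, eq_C_of_natDegree_eq_zero ?_⟩
      have := congrArg natDegree h2
      rwa [natDegree_C, natDegree_C_mul (by simpa using hp.ne_zero), eq_comm] at this
    rw [← C_mul] at h2
    have h3 := C_injective h2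
    subst h3
    have hb' : b' ≠ 0 := by rintro rfl; simp at ha
    refine ih b'.natAbs ?_ hs' hb' (by rw [hb, mul_comm]) rfl
    rw [← hn, Int.natAbs_mul, Int.natAbs_mul, ← mul_assoc, Int.natAbs_natCast]
    have := hp.two_le
    have := Int.natAbs_pos.2 hb'
    nlinarith [Nat.mul_le_mul hp.two_le hp.two_le]

theorem eq_span_singleton_of_norm_eq (hm : f.Monic) (hf : Odd f.natDegree)
    {I J : Ideal (QuadRing f)} {c s : QuadRing f} (hc : c ≠ 0) (hIJ : I * J = Ideal.span {c})
    {d : ℤ[X]} (hd : IsNormGCD I d) (hd0 : d ≠ 0) (hs : s ∈ I) {a : ℤ} (ha : a ≠ 0)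
    (hsa : s.norm = C a * d) : ∃ s', I = Ideal.span {s'} := by
  obtain ⟨s', hs', h⟩ := exists_associated_norm hm hf hc hIJ hd hd0 hs ha hsa
  refine ⟨s', eq_span_singleton_of_norm_dvd hf hc hIJ hs' ?_
    fun a ha => h.dvd.trans (hd.dvd_norm ha)⟩
  rintro rfl
  rw [QuadraticAlgebra.norm_zero] at h
  exact hd0 (h.eq_zero_iff.1 rfl)

/-! ### Growth as `n → -∞` and the definite forms at `x = n`. -/

-- Turns the estimates at infinitely many negative integers into a comparison of degrees; the
-- substitution `x ↦ -x` moves the limit to `+∞`.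
open Filter Topology in
theorem degree_le_of_abs_eval_le {P Q : ℤ[X]} {K : ℤ} {S : Set ℤ} (hS : S.Infinite)
    (hneg : ∀ n ∈ S, n < 0) (h : ∀ n ∈ S, |P.eval n| ≤ K * |Q.eval n|) :
    P.degree ≤ Q.degree := by
  by_contra! hlt
  have hcomp : ∀ p : ℤ[X], ((p.comp (-X)).map (Int.castRingHom ℝ)).degree = p.degree := fun p => by
    rw [degree_map_eq_of_injective (Int.castRingHom ℝ).injective_int]
    exact p.degree_comp_neg_X
  have heval : ∀ (p : ℤ[X]) (m : ℕ), ((p.comp (-X)).map (Int.castRingHom ℝ)).eval (m : ℝ) =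
      ((p.eval (-(m : ℤ)) : ℤ) : ℝ) := fun p m => by
    simp
  have hlim := (div_tendsto_atTop_zero_of_degree_lt ((Q.comp (-X)).map (Int.castRingHom ℝ))
    ((P.comp (-X)).map (Int.castRingHom ℝ)) (by rwa [hcomp, hcomp])).comp
      (tendsto_natCast_atTop_atTop (R := ℝ))
  have hpos : (0 : ℝ) < 1 / (|(K : ℝ)| + 1) := by positivity
  have hev := hlim.eventually (Metric.ball_mem_nhds 0 hpos)
  have hP0 : P ≠ 0 := by rintro rfl; simp at hlt
  have hroots : {n : ℤ | P.eval n = 0}.Finite := by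
    have := P.roots.toFinset.finite_toSet
    refine this.subset fun n hn => ?_
    simpa [hP0] using hn
  obtain ⟨M, hM⟩ := eventually_atTop.1 hev
  have hfin : S ⊆ {n : ℤ | P.eval n = 0} ∪ Set.Icc (-(M : ℤ)) 0 := by
    intro n hn
    by_contra hn'
    simp only [Set.mem_union, Set.mem_ofPred_eq, Set.mem_Icc, not_or, not_and, not_le] at hn'
    have hn0 := hneg n hn
    obtain ⟨m, rfl⟩ : ∃ m : ℕ, n = -(m : ℤ) := ⟨n.natAbs, by omega⟩
    have hMm : M ≤ m := by
      by_contra! hlt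
      have := hn'.2 (by omega)
      omega
    have h1 := hM m hMm
    simp only [Function.comp_apply, heval, dist_zero_right, norm_div,
      Real.norm_eq_abs] at h1
    have hPm : (0 : ℝ) < |((P.eval (-(m : ℤ)) : ℤ) : ℝ)| := abs_pos.2 (by exact_mod_cast hn'.1)
    rw [div_lt_div_iff₀ hPm (by positivity), one_mul] at h1
    have h2 : |((P.eval (-(m : ℤ)) : ℤ) : ℝ)| ≤ K * |((Q.eval (-(m : ℤ)) : ℤ) : ℝ)| := by
      exact_mod_cast h _ hn
    have h3 := abs_nonneg (((Q.eval (-(m : ℤ)) : ℤ) : ℝ))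
    nlinarith [le_abs_self (K : ℝ)]
  exact hS ((hroots.union (Set.finite_Icc _ _)).subset hfin)

/-- If `t` generates `I` modulo `x - n`, then its norm, relative to that of `I`, is at `x = n` a
divisor of a fixed integer. -/
theorem eval_dvd_of_generates_mod {I : Ideal (QuadRing f)} {d : ℤ[X]} (hd : IsNormGCD I d)
    (hd0 : d ≠ 0) {D : ℤ}
    (hD : C D * d ∈ Ideal.span (QuadraticAlgebra.norm '' (I : Set (QuadRing f)))) {n : ℤ}
    {t : QuadRing f} (ht : t ∈ I)
    (hgen : ∀ a ∈ I, ∃ r, ∃ w ∈ I, a = r * t + (X - C n) • w) {ν : ℤ[X]}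
    (hν : t.norm = d * ν) : ν.eval n ∣ D := by
  have key : ∀ x ∈ Ideal.span (QuadraticAlgebra.norm '' (I : Set (QuadRing f))),
      ∃ ρ : ℤ[X], x = d * ρ ∧ ν.eval n ∣ ρ.eval n := by
    intro x hx
    induction hx using Submodule.span_induction with
    | mem x hx =>
      obtain ⟨a, ha, rfl⟩ := hx
      obtain ⟨r, w, hw, rfl⟩ := hgen a ha
      obtain ⟨b, hb⟩ : d ∣ (r * t + w).norm - (r * t).norm - w.norm :=
        dvd_sub (dvd_sub (hd.dvd_norm (I.add_mem (I.mul_mem_left _ ht) hw))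
          (hd.dvd_norm (I.mul_mem_left _ ht))) (hd.dvd_norm hw)
      obtain ⟨e, he⟩ := hd.dvd_norm hw
      -- Expansion of `N(r t + (x - n) w) / d`; only the first term survives at `x = n`.
      refine ⟨r.norm * ν + (X - C n) * b + (X - C n) ^ 2 * e, ?_, by simp⟩
      rw [norm_add] at hb ⊢
      rw [norm_smul, he, norm_mul, hν] at *
      simp only [QuadraticAlgebra.re_smul, QuadraticAlgebra.im_smul, smul_eq_mul]
      linear_combination (X - C n) * hb
    | zero => exact ⟨0, by simp, by simp⟩
    | add x y _ _ hx hy =>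
      obtain ⟨u, rfl, hu⟩ := hx
      obtain ⟨v, rfl, hv⟩ := hy
      exact ⟨u + v, by ring, by rw [eval_add]; exact dvd_add hu hv⟩
    | smul r x _ hx =>
      obtain ⟨u, rfl, hu⟩ := hx
      exact ⟨r * u, by rw [smul_eq_mul]; ring, by rw [eval_mul]; exact hu.mul_left _⟩
  obtain ⟨ρ, hρ, h⟩ := key _ hD
  rw [mul_comm] at hρ
  rw [← mul_left_cancel₀ hd0 hρ, eval_C] at h
  exact h

/-- Cramer's rule for `(U, V) = p (u₁, v₁) + q (u₂, v₂)` and a definite form. -/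
theorem cramer_bound {F U V u₁ v₁ u₂ v₂ p q B : ℤ} (hF : 0 ≤ F) (hU : U = p * u₁ + q * u₂)
    (hV : V = p * v₁ + q * v₂) (hB : U ^ 2 + F * V ^ 2 ≤ B) :
    q ^ 2 * ((u₁ * v₂ - u₂ * v₁) ^ 2 * F) ≤ 2 * B * (u₁ ^ 2 + F * v₁ ^ 2) := by
  have h1 : q * (u₁ * v₂ - u₂ * v₁) = u₁ * V - v₁ * U := by rw [hU, hV]; ring
  have h2 : q ^ 2 * ((u₁ * v₂ - u₂ * v₁) ^ 2 * F) = (u₁ * V - v₁ * U) ^ 2 * F := by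
    rw [← h1]; ring
  rw [h2]
  have hUB : U ^ 2 ≤ B := by nlinarith [mul_nonneg hF (sq_nonneg V)]
  have hVB : F * V ^ 2 ≤ B := by nlinarith [sq_nonneg U]
  have h3 : (u₁ * V - v₁ * U) ^ 2 * F ≤ 2 * (u₁ ^ 2 * V ^ 2 + v₁ ^ 2 * U ^ 2) * F :=
    mul_le_mul_of_nonneg_right (by nlinarith [sq_nonneg (u₁ * V + v₁ * U)]) hF
  have h4 : u₁ ^ 2 * (F * V ^ 2) ≤ u₁ ^ 2 * B := mul_le_mul_of_nonneg_left hVB (sq_nonneg _)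
  have h5 : F * v₁ ^ 2 * U ^ 2 ≤ F * v₁ ^ 2 * B :=
    mul_le_mul_of_nonneg_left hUB (mul_nonneg hF (sq_nonneg _))
  nlinarith

theorem exists_norm_eq_of_degree_le (hf : Odd f.natDegree) {I : Ideal (QuadRing f)} {d : ℤ[X]}
    (hd : IsNormGCD I d) {s : QuadRing f} (hs : s ∈ I) (hs0 : s ≠ 0)
    (hle : s.norm.degree ≤ d.degree) : ∃ s ∈ I, ∃ a : ℤ, a ≠ 0 ∧ s.norm = C a * d := by
  obtain ⟨b, hb⟩ := hd.dvd_norm hs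
  have hn0 : s.norm ≠ 0 := (norm_eq_zero hf).not.2 hs0
  have hd0 : d ≠ 0 := by rintro rfl; simp_all
  have hb0 : b ≠ 0 := by rintro rfl; simp_all
  have h1 := natDegree_le_natDegree hle
  rw [hb, natDegree_mul hd0 hb0] at h1
  have h2 := eq_C_of_natDegree_eq_zero (p := b) (by omega)
  refine ⟨s, hs, b.coeff 0, fun h => hb0 (by rw [h2, h, C_0]), ?_⟩
  rw [← h2, hb, mul_comm]

/-- An ideal that is principal modulo `x - n` for infinitely many `n < 0` with `f(n) < 0` contains
an element whose norm is a constant multiple of the norm of the ideal. -/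
theorem exists_norm_eq_const_mul (hf : Odd f.natDegree) {I : Ideal (QuadRing f)} (hI : I ≠ ⊥)
    {d : ℤ[X]} (hd : IsNormGCD I d) (hd0 : d ≠ 0) {D : ℤ} (hD0 : D ≠ 0)
    (hD : C D * d ∈ Ideal.span (QuadraticAlgebra.norm '' (I : Set (QuadRing f))))
    (hinf : {n : ℤ | n < 0 ∧ f.eval n < 0 ∧
      ∃ t ∈ I, ∀ a ∈ I, ∃ r, ∃ w ∈ I, a = r * t + (X - C n) • w}.Infinite) :
    ∃ s ∈ I, ∃ a : ℤ, a ≠ 0 ∧ s.norm = C a * d := by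
  obtain ⟨s₁, h₁I, s₂, h₂I, h₁0, h₂0, h₁, h₂, hspan⟩ := exists_reduced_pair hf hI
  obtain ⟨E, hE0, hE⟩ := exists_common_multiplier I (Submodule.span ℤ[X] {s₁, s₂})
    fun a ha => by
      obtain ⟨D, p, q, hD, h⟩ := hspan a ha
      exact ⟨D, hD, Submodule.mem_span_pair.2 ⟨p, q, h.symm⟩⟩
  set S := {n : ℤ | n < 0 ∧ f.eval n < 0 ∧
      ∃ t ∈ I, ∀ a ∈ I, ∃ r, ∃ w ∈ I, a = r * t + (X - C n) • w}
  set w : ℤ[X] := s₁.re * s₂.im - s₂.re * s₁.im with hw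
  have hn₁ : s₁.norm ≠ 0 := (norm_eq_zero hf).not.2 h₁0
  have hn₂ : s₂.norm ≠ 0 := (norm_eq_zero hf).not.2 h₂0
  -- Up to sign, the determinant `w` is the `y`-coordinate of `s₁ * star s₂`, whose norm has odd
  -- degree, so `f w²` is its leading term.
  have hdeg : (w ^ 2 * f).degree = s₁.norm.degree + s₂.norm.degree := by
    have hnorm : (s₁ * star s₂).norm = s₁.norm * s₂.norm := by
      rw [norm_mul, QuadraticAlgebra.norm_star]
    have ho : Odd (s₁ * star s₂).norm.natDegree := by
      rw [hnorm, natDegree_mul hn₁ hn₂]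
      exact h₁.add_odd h₂
    rw [← degree_mul, ← hnorm, (degree_norm_of_odd hf ho).1]
    congr 1
    simp only [QuadraticAlgebra.im_mul, QuadraticAlgebra.re_star, QuadraticAlgebra.im_star, hw]
    ring
  -- Zeros of `d` are discarded so that `N(t)(n) ≠ 0`, which prevents `p(n)` and `q(n)` from both
  -- vanishing.
  have hbound : ∀ n ∈ S \ {n | d.eval n = 0},
      |(w ^ 2 * f).eval n| ≤ (2 * (E ^ 2 * |D|)) * |(d * s₁.norm).eval n| ∨
      |(w ^ 2 * f).eval n| ≤ (2 * (E ^ 2 * |D|)) * |(d * s₂.norm).eval n| := by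
    rintro n ⟨⟨hn, hfn, t, ht, hgen⟩, hdn⟩
    obtain ⟨ν, hν⟩ := hd.dvd_norm ht
    have hνD := eval_dvd_of_generates_mod hd hd0 hD ht hgen hν
    have hνle : |ν.eval n| ≤ |D| := Int.le_of_dvd (abs_pos.2 hD0) ((abs_dvd_abs _ _).2 hνD)
    have hν0 : ν.eval n ≠ 0 := fun h => hD0 (zero_dvd_iff.1 (h ▸ hνD))
    obtain ⟨p, q, hpq⟩ := Submodule.mem_span_pair.1 (hE t ht)
    have hnE : (C E • t).norm = C E ^ 2 * (d * ν) := by rw [norm_smul, hν]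
    have hU : (C E • t).re.eval n = p.eval n * s₁.re.eval n + q.eval n * s₂.re.eval n := by
      rw [← hpq]; simp
    have hV : (C E • t).im.eval n = p.eval n * s₁.im.eval n + q.eval n * s₂.im.eval n := by
      rw [← hpq]; simp
    have hev : ∀ z : QuadRing f, z.norm.eval n =
        z.re.eval n ^ 2 + (-f.eval n) * z.im.eval n ^ 2 := fun z => by
      rw [norm_eq, eval_sub, eval_mul, eval_pow, eval_pow]; ring
    have hev0 : ∀ z : QuadRing f, 0 ≤ z.norm.eval n := fun z => by
      rw [hev]; nlinarith [mul_nonneg (neg_nonneg.2 hfn.le) (sq_nonneg (z.im.eval n)),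
        sq_nonneg (z.re.eval n)]
    have hval : (C E • t).norm.eval n = E ^ 2 * (d.eval n * ν.eval n) := by rw [hnE]; simp
    have hB : (C E • t).norm.eval n ≤ E ^ 2 * |D| * |d.eval n| := by
      rw [hval]
      calc E ^ 2 * (d.eval n * ν.eval n) ≤ E ^ 2 * (|d.eval n| * |ν.eval n|) := by
            rw [← abs_mul]; gcongr; exact le_abs_self _
        _ ≤ E ^ 2 * (|d.eval n| * |D|) := by gcongr
        _ = _ := by ring
    rw [hev] at hB
    have hwf : |(w ^ 2 * f).eval n| = w.eval n ^ 2 * (-f.eval n) := by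
      rw [eval_mul, eval_pow, abs_mul, abs_of_neg hfn, abs_of_nonneg (sq_nonneg _)]
    have hw' : w.eval n = s₁.re.eval n * s₂.im.eval n - s₂.re.eval n * s₁.im.eval n := by
      simp [hw]
    have hwf0 : 0 ≤ w.eval n ^ 2 * (-f.eval n) := mul_nonneg (sq_nonneg _) (neg_nonneg.2 hfn.le)
    -- Integrality enters here: a nonzero value of `p` or `q` at `n` has square at least `1`.
    have hsq : ∀ m : ℤ, m ≠ 0 → w.eval n ^ 2 * (-f.eval n) ≤
        m ^ 2 * (w.eval n ^ 2 * (-f.eval n)) := fun m hm =>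
      le_mul_of_one_le_left hwf0 (Int.add_one_le_iff.2 (sq_pos_iff.2 hm))
    have hrhs : ∀ z : QuadRing f, 2 * (E ^ 2 * |D|) * |(d * z.norm).eval n| =
        2 * (E ^ 2 * |D| * |d.eval n|) * (z.re.eval n ^ 2 + (-f.eval n) * z.im.eval n ^ 2) :=
      fun z => by
        rw [eval_mul, abs_mul, abs_of_nonneg (hev0 z), hev]; ring
    rw [hwf, hrhs, hrhs]
    by_cases hq : q.eval n = 0
    · right
      have hp : p.eval n ≠ 0 := by
        intro hp
        have h0 : (C E • t).norm.eval n = 0 := by rw [hev, hU, hV, hp, hq]; ring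
        rw [hval] at h0
        simp_all
      refine (hsq _ hp).trans ?_
      rw [hw', show (s₁.re.eval n * s₂.im.eval n - s₂.re.eval n * s₁.im.eval n) ^ 2 =
        (s₂.re.eval n * s₁.im.eval n - s₁.re.eval n * s₂.im.eval n) ^ 2 by ring]
      exact cramer_bound (p := q.eval n) (neg_nonneg.2 hfn.le) (by rw [hU]; ring)
        (by rw [hV]; ring) hB
    · left
      refine (hsq _ hq).trans ?_
      rw [hw']
      exact cramer_bound (neg_nonneg.2 hfn.le) hU hV hB
  have hSinf : (S \ {n | d.eval n = 0}).Infinite := by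
    refine hinf.sdiff ?_
    refine d.roots.toFinset.finite_toSet.subset fun n hn => ?_
    simpa [hd0] using hn
  have hcancel : ∀ {a b e : ℤ[X]}, a ≠ 0 → (w ^ 2 * f).degree = a.degree + b.degree →
      (w ^ 2 * f).degree ≤ (e * a).degree → b.degree ≤ e.degree := by
    intro a b e ha h1 h2
    rw [h1, degree_mul, add_comm] at h2
    exact WithBot.le_of_add_le_add_right (by simpa [degree_eq_bot] using ha) h2
  have hsplit := hSinf.mono (t :=
    {n | n < 0 ∧ |(w ^ 2 * f).eval n| ≤ (2 * (E ^ 2 * |D|)) * |(d * s₁.norm).eval n|} ∪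
    {n | n < 0 ∧ |(w ^ 2 * f).eval n| ≤ (2 * (E ^ 2 * |D|)) * |(d * s₂.norm).eval n|})
    fun n hn => (hbound n hn).imp (fun h => ⟨hn.1.1, h⟩) (fun h => ⟨hn.1.1, h⟩)
  -- A bound through `N(s₁)` cancels against `deg w² f = deg N(s₁) + deg N(s₂)` to give `deg N(s₂) ≤
  -- deg d`, and symmetrically.
  rcases Set.infinite_union.1 hsplit with h | h
  · exact exists_norm_eq_of_degree_le hf hd h₂I h₂0 (hcancel hn₁ hdeg
      (degree_le_of_abs_eval_le h (fun n hn => hn.1) (fun n hn => hn.2)))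
  · exact exists_norm_eq_of_degree_le hf hd h₁I h₁0 (hcancel hn₂ (by rw [hdeg, add_comm])
      (degree_le_of_abs_eval_le h (fun n hn => hn.1) (fun n hn => hn.2)))

/-- An invertible ideal that is principal modulo `x - n` for infinitely many `n < 0` with
`f(n) < 0` is principal. -/
theorem exists_eq_span_singleton (hm : f.Monic) (hf : Odd f.natDegree)
    {I J : Ideal (QuadRing f)} {c : QuadRing f} (hc : c ≠ 0) (hIJ : I * J = Ideal.span {c})
    (hinf : {n : ℤ | n < 0 ∧ f.eval n < 0 ∧
      ∃ t ∈ I, ∀ a ∈ I, ∃ r, ∃ w ∈ I, a = r * t + (X - C n) • w}.Infinite) :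
    ∃ s, I = Ideal.span {s} := by
  have hI : I ≠ ⊥ := by
    rintro rfl
    rw [Ideal.bot_mul, eq_comm, Ideal.span_singleton_eq_bot] at hIJ
    exact hc hIJ
  obtain ⟨d, hd, D, hD0, hD⟩ := exists_isNormGCD hf hI
  have hd0 : d ≠ 0 := by
    rintro rfl
    obtain ⟨b, hb, hb0⟩ := (Submodule.ne_bot_iff I).1 hI
    exact hb0 ((norm_eq_zero hf).1 (zero_dvd_iff.1 (hd.dvd_norm hb)))
  obtain ⟨s, hs, a, ha, h⟩ := exists_norm_eq_const_mul hf hI hd hd0 hD0 hD hinf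
  exact eq_span_singleton_of_norm_eq hm hf hc hIJ hd hd0 hs ha h

end QuadRing

/-! ### Picard groups: finiteness for orders, and ideals representing invertible modules. -/

section Pic

open CommRing TensorProduct

theorem finite_ideals_ge {S : Type*} [CommRing S] (I : Ideal S) [Finite (S ⧸ I)] :
    {J : Ideal S | I ≤ J}.Finite := by
  have : Finite (Ideal (S ⧸ I)) := Finite.of_injective (fun J => (J : Set (S ⧸ I)))
    SetLike.coe_injective
  refine (Set.finite_range fun K : Ideal (S ⧸ I) => K.comap (Ideal.Quotient.mk I)).subset
    fun J hJ => ⟨J.map (Ideal.Quotient.mk I), ?_⟩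
  beta_reduce
  rw [Ideal.comap_map_of_surjective _ Ideal.Quotient.mk_surjective, ← RingHom.ker_eq_comap_bot,
    Ideal.mk_ker]
  exact sup_eq_left.2 hJ

/-- An order in a number field has finite Picard group, maximal or not. -/
theorem finite_pic_of_finite_int (S : Type*) [CommRing S] [IsDomain S] [Module.Free ℤ S]
    [Module.Finite ℤ S] : Finite (Pic S) := by
  classical
  let bS := Module.Free.chooseBasis ℤ S
  let M : ℤ := ∏ m ∈ ClassGroup.finsetApprox bS AbsoluteValue.absIsAdmissible, m
  have hM : algebraMap ℤ S M ≠ 0 :=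
    ClassGroup.prod_finsetApprox_ne_zero bS AbsoluteValue.absIsAdmissible
  have : Finite (S ⧸ Ideal.span {algebraMap ℤ S M}) :=
    Ideal.finiteQuotientOfFreeOfNeBot _ (by rwa [ne_eq, Ideal.span_singleton_eq_bot])
  have : Finite {J : Ideal S // Ideal.span {algebraMap ℤ S M} ≤ J} :=
    (finite_ideals_ge (Ideal.span {algebraMap ℤ S M})).to_subtype
  have key : ∀ L : Pic S, ∃ J : {J : Ideal S // Ideal.span {algebraMap ℤ S M} ≤ J},
      Nonempty (L ≃ₗ[S] J.1) := by
    intro L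
    obtain ⟨I, ⟨e⟩⟩ := Module.Invertible.exists_linearEquiv_ideal S L
    have hI : I ≠ ⊥ := by
      rintro rfl
      have : Subsingleton L := e.toEquiv.subsingleton
      have h : (1 : S) = 0 := FaithfulSMul.eq_of_smul_eq_smul (α := L)
        fun a => Subsingleton.elim _ _
      exact one_ne_zero h
    -- With `b` a nonzero element of `I` of least absolute norm, approximation gives `M I ⊆ b S`. So
    -- `I` is isomorphic to the ideal `(M / b) I`, which contains `M`, and only finitely many ideals
    -- do.
    obtain ⟨b, hb, hb0, hmin⟩ := ClassGroup.exists_min AbsoluteValue.abs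
      (⟨I, mem_nonZeroDivisors_of_ne_zero hI⟩ : nonZeroDivisors (Ideal S))
    let F := Submodule.map (LinearMap.mulLeft S (algebraMap ℤ S M)) I
    have hdvd : ∀ a ∈ I, b ∣ algebraMap ℤ S M * a := by
      intro a ha
      obtain ⟨q, r, hr, hlt⟩ := ClassGroup.exists_mem_finset_approx' bS
        AbsoluteValue.absIsAdmissible a hb0
      have h0 := hmin _ (I.sub_mem (Submodule.smul_of_tower_mem I r ha) (I.mul_mem_left q hb)) hlt
      obtain ⟨k, hk⟩ : r ∣ M := Finset.dvd_prod_of_mem _ hr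
      refine ⟨algebraMap ℤ S k * q, ?_⟩
      rw [Algebra.smul_def, sub_eq_zero] at h0
      rw [hk, map_mul]
      linear_combination (algebraMap ℤ S k) * h0
    have hrange : F ≤ LinearMap.range (LinearMap.mulLeft S b) := by
      rintro _ ⟨a, ha, rfl⟩
      obtain ⟨x, hx⟩ := hdvd a ha
      exact ⟨x, hx.symm⟩
    refine ⟨⟨Submodule.comap (LinearMap.mulLeft S b) F, ?_⟩, ⟨e ≪≫ₗ
      Submodule.equivMapOfInjective _ (mul_right_injective₀ hM) I ≪≫ₗ
      LinearEquiv.ofEq _ _ (Submodule.map_comap_eq_of_le hrange).symm ≪≫ₗ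
      (Submodule.equivMapOfInjective _ (mul_right_injective₀ hb0) _).symm⟩⟩
    rw [Ideal.span_singleton_le_iff_mem]
    exact ⟨b, hb, mul_comm _ _⟩
  choose J hJ using key
  refine Finite.of_injective J fun L L' h => ?_
  obtain ⟨e⟩ := hJ L
  obtain ⟨e'⟩ := hJ L'
  rw [← h] at e'
  exact Pic.ext_iff.2 ⟨e ≪≫ₗ e'.symm⟩

/-- Over a domain, an invertible module is an ideal with a complement up to a principal ideal. -/
theorem exists_ideal_mul_eq_span_singleton (R M : Type*) [CommRing R] [IsDomain R]
    [AddCommGroup M] [Module R M] [Module.Invertible R M] :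
    ∃ (I J : Ideal R) (c : R), c ≠ 0 ∧ I * J = Ideal.span {c} ∧ Nonempty (M ≃ₗ[R] I) := by
  obtain ⟨I, ⟨e⟩⟩ := Module.Invertible.exists_linearEquiv_ideal R M
  obtain ⟨J, ⟨e'⟩⟩ := Module.Invertible.exists_linearEquiv_ideal R (Module.Dual R M)
  have : Module.Invertible R J := .congr e'
  have hdisj : Submodule.LinearDisjoint I J :=
    .of_left_le_one_of_flat I J (le_top.trans Ideal.one_eq_top.ge)
  -- Flatness of `I` identifies `I ⊗ J` with `I * J`; the tensor product of a module and its dual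
  -- being free of rank one, `I * J` is generated by `φ 1`.
  let φ : R ≃ₗ[R] ↥(I * J) := (Module.Invertible.linearEquiv R M).symm ≪≫ₗ
    TensorProduct.comm R _ _ ≪≫ₗ TensorProduct.congr e e' ≪≫ₗ hdisj.mulMap
  refine ⟨I, J, (φ 1 : R), ?_, ?_, ⟨e⟩⟩
  · intro h
    have : φ 1 = 0 := Subtype.ext h
    exact one_ne_zero ((map_eq_zero_iff φ φ.injective).1 this)
  · refine le_antisymm (fun x hx => ?_) ((Ideal.span_singleton_le_iff_mem _).2 (φ 1).2)
    rw [Ideal.mem_span_singleton]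
    refine ⟨φ.symm ⟨x, hx⟩, ?_⟩
    have : φ (φ.symm ⟨x, hx⟩ • 1) = ⟨x, hx⟩ := by simp
    rw [map_smul] at this
    have := congrArg Subtype.val this
    rw [mul_comm]
    exact this.symm

/-- A module that becomes free of rank one modulo `x` is generated by one element modulo `x`. -/
theorem exists_generator_mod {R S M : Type*} [CommRing R] [CommRing S] [Algebra R S]
    [AddCommGroup M] [Module R M] (hsurj : Function.Surjective (algebraMap R S)) {x : R}
    (hker : RingHom.ker (algebraMap R S) = Ideal.span {x}) (e : S ⊗[R] M ≃ₗ[S] S) :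
    ∃ t : M, ∀ m : M, ∃ (r : R) (w : M), m = r • t + x • w := by
  obtain ⟨t, ht⟩ := TensorProduct.mk_surjective R M S hsurj (e.symm 1)
  refine ⟨t, fun m => ?_⟩
  obtain ⟨r, hr⟩ := hsurj (e (1 ⊗ₜ m))
  have h0 : (1 : S) ⊗ₜ[R] (m - r • t) = 0 := by
    rw [tmul_sub, tmul_smul, sub_eq_zero]
    apply e.injective
    change _ = e (r • (TensorProduct.mk R S M 1) t)
    rw [ht, ← algebraMap_smul S r, map_smul, e.apply_symm_apply, hr, smul_eq_mul, mul_one]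
  -- Through `S ≅ R / (x)`, the vanishing of `1 ⊗ (m - r • t)` says that `m - r • t` lies in `x M`.
  let k : S →ₗ[R] R ⧸ RingHom.ker (Algebra.ofId R S) :=
    (Ideal.quotientKerAlgEquivOfSurjective (f := Algebra.ofId R S) hsurj).symm.toLinearMap
  have h1 := congrArg (TensorProduct.quotTensorEquivQuotSMul M (RingHom.ker (Algebra.ofId R S)))
    (congrArg (LinearMap.rTensor M k) h0)
  have hk : k 1 = 1 := map_one
    (Ideal.quotientKerAlgEquivOfSurjective (f := Algebra.ofId R S) hsurj).symm
  rw [LinearMap.rTensor_tmul, hk, quotTensorEquivQuotSMul_mk_one_tmul, map_zero, map_zero,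
    Submodule.Quotient.mk_eq_zero] at h1
  have hker' : RingHom.ker (Algebra.ofId R S) = Ideal.span {x} := hker
  rw [hker', Submodule.ideal_span_singleton_smul, Submodule.mem_smul_pointwise_iff_exists] at h1
  obtain ⟨w, -, hw⟩ := h1
  exact ⟨r, w, by rw [hw]; abel⟩

end Pic

/-! ### The rings `ℤ[√f(n)]` and specialisation at `x = n`. -/

theorem zsqrtd_isDomain {d : ℤ} (hd : d < 0) : IsDomain (ℤ√d) :=
  have : NoZeroDivisors (ℤ√d) := ⟨fun {a b} h => by
    rw [← Zsqrtd.norm_eq_zero_iff hd, ← Zsqrtd.norm_eq_zero_iff hd, ← mul_eq_zero,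
      ← Zsqrtd.norm_mul, h, Zsqrtd.norm_zero]⟩
  NoZeroDivisors.to_isDomain _

/-- The basis `1, √d` of `ℤ[√d]`. -/
noncomputable def zsqrtdLinearEquiv (d : ℤ) : (ℤ√d) ≃ₗ[ℤ] ℤ × ℤ :=
  AddEquiv.toIntLinearEquiv
    { toFun := fun z => (z.re, z.im)
      invFun := fun p => ⟨p.1, p.2⟩
      left_inv := fun _ => rfl
      right_inv := fun _ => rfl
      map_add' := fun _ _ => rfl }

theorem finite_pic_zsqrtd {d : ℤ} (hd : d < 0) : Finite (CommRing.Pic (ℤ√d)) := by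
  have := zsqrtd_isDomain hd
  have : Module.Free ℤ (ℤ√d) := Module.Free.of_equiv (zsqrtdLinearEquiv d).symm
  have : Module.Finite ℤ (ℤ√d) := Module.Finite.equiv (zsqrtdLinearEquiv d).symm
  exact finite_pic_of_finite_int _

theorem root_mul_root (f : ℤ[X]) :
    (AdjoinRoot.root (X ^ 2 - C f : ℤ[X][X]) : CoordRing f) * AdjoinRoot.root _ =
      f • 1 + (0 : ℤ[X]) • AdjoinRoot.root _ := by
  have := AdjoinRoot.eval₂_root (X ^ 2 - C f : ℤ[X][X])
  rw [eval₂_sub, eval₂_X_pow, eval₂_C, sub_eq_zero] at this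
  rw [← pow_two, this, zero_smul, add_zero, Algebra.smul_def, mul_one]
  rfl

/-- The coordinate ring is free over `ℤ[x]` with basis `1, y`. -/
noncomputable def quadEquiv (f : ℤ[X]) : QuadRing f ≃ₐ[ℤ[X]] CoordRing f :=
  AlgEquiv.ofAlgHom
    (QuadraticAlgebra.lift ⟨AdjoinRoot.root (X ^ 2 - C f : ℤ[X][X]), root_mul_root f⟩)
    (AdjoinRoot.liftAlgHom _ (Algebra.ofId _ _) QuadraticAlgebra.omega (by
      rw [eval₂_sub, eval₂_X_pow, eval₂_C, pow_two, QuadraticAlgebra.omega_mul_omega_eq_mk]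
      exact sub_self _))
    (by ext; simp)
    (by ext <;> simp)

theorem specHom_quadEquiv (f : ℤ[X]) (n : ℤ) (z : QuadRing f) :
    specHom f n (quadEquiv f z) = ⟨z.re.eval n, z.im.eval n⟩ := by
  have h : quadEquiv f z = AdjoinRoot.of _ z.re + AdjoinRoot.of _ z.im * AdjoinRoot.root _ := by
    change QuadraticAlgebra.lift (⟨AdjoinRoot.root _, root_mul_root f⟩ :
      {u : CoordRing f // u * u = f • 1 + (0 : ℤ[X]) • u}) z = _
    simp [QuadraticAlgebra.lift, Algebra.smul_def]
  rw [h, map_add, map_mul, specHom_of, specHom_of, specHom_root]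
  ext <;> simp

theorem specHom_surjective (f : ℤ[X]) (n : ℤ) : Function.Surjective (specHom f n) := fun z =>
  ⟨quadEquiv f ⟨C z.re, C z.im⟩, by rw [specHom_quadEquiv]; simp⟩

theorem ker_specHom (f : ℤ[X]) (n : ℤ) :
    RingHom.ker (specHom f n) = Ideal.span {quadEquiv f (algebraMap _ _ (X - C n))} := by
  refine le_antisymm (fun z hz => ?_) ?_
  · obtain ⟨z, rfl⟩ := (quadEquiv f).surjective z
    rw [RingHom.mem_ker, specHom_quadEquiv, Zsqrtd.ext_iff] at hz
    rw [Ideal.mem_span_singleton]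
    refine map_dvd (quadEquiv f) ?_
    rw [QuadraticAlgebra.algebraMap_dvd_iff, dvd_iff_isRoot, dvd_iff_isRoot]
    exact hz
  · rw [Ideal.span_singleton_le_iff_mem, RingHom.mem_ker, specHom_quadEquiv]
    ext <;> simp

open CommRing TensorProduct in
theorem exists_generator_of_pullback_eq_one {f : ℤ[X]} {n : ℤ} {L : Pic (CoordRing f)}
    {I : Ideal (CoordRing f)} (e : L ≃ₗ[CoordRing f] I) (h : pullback f n L = 1) :
    ∃ t ∈ I.comap (quadEquiv f).toRingEquiv, ∀ a ∈ I.comap (quadEquiv f).toRingEquiv,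
      ∃ r, ∃ w ∈ I.comap (quadEquiv f).toRingEquiv, a = r * t + (X - C n) • w := by
  unfold pullback Pic.mapRingHom at h
  algebraize [specHom f n]
  change Pic.mapAlgebra _ _ L = 1 at h
  rw [Pic.mapAlgebra_apply, Pic.mk_eq_one_iff] at h
  obtain ⟨e'⟩ := h
  obtain ⟨t, ht⟩ := exists_generator_mod (specHom_surjective f n) (ker_specHom f n) e'
  refine ⟨(quadEquiv f).symm (e t), ?_, fun a ha => ?_⟩
  · rw [Ideal.mem_comap]
    exact ((quadEquiv f).apply_symm_apply (e t : CoordRing f)).symm ▸ (e t).2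
  · obtain ⟨r, w, hw⟩ := ht (e.symm ⟨quadEquiv f a, ha⟩)
    refine ⟨(quadEquiv f).symm r, (quadEquiv f).symm (e w), ?_, ?_⟩
    · rw [Ideal.mem_comap]
      exact ((quadEquiv f).apply_symm_apply (e w : CoordRing f)).symm ▸ (e w).2
    · have h1 := congrArg (fun m => (e m : CoordRing f)) hw
      simp only [LinearEquiv.apply_symm_apply, map_add, map_smul, Submodule.coe_add,
        Submodule.coe_smul, smul_eq_mul] at h1
      apply (quadEquiv f).injective
      rw [h1, map_add, map_mul, Algebra.smul_def, map_mul, AlgEquiv.apply_symm_apply,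
        AlgEquiv.apply_symm_apply, AlgEquiv.apply_symm_apply]

/-! ### Triviality from infinitely many specialisations, and the theorem. -/

/-- A line bundle that becomes trivial at infinitely many of the sections `T_n` is trivial. -/
theorem eq_one_of_infinite_pullback_eq_one {f : ℤ[X]} (hm : f.Monic) (hf : Odd f.natDegree)
    {L : CommRing.Pic (CoordRing f)}
    (hinf : {n : ℤ | n < 0 ∧ f.eval n < 0 ∧ pullback f n L = 1}.Infinite) : L = 1 := by
  have := QuadRing.isDomain hf
  have : IsDomain (CoordRing f) := (quadEquiv f).symm.toMulEquiv.isDomain _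
  obtain ⟨I, J, c, hc, hIJ, ⟨e⟩⟩ := exists_ideal_mul_eq_span_singleton (CoordRing f) L
  have hmul : I.comap (quadEquiv f).toRingEquiv * J.comap (quadEquiv f).toRingEquiv =
      Ideal.span {(quadEquiv f).symm c} := by
    rw [← Ideal.map_symm, ← Ideal.map_symm, ← Ideal.map_mul, hIJ, Ideal.map_span,
      Set.image_singleton]
    rfl
  obtain ⟨s, hs⟩ := QuadRing.exists_eq_span_singleton hm hf
    ((map_ne_zero_iff _ (quadEquiv f).symm.injective).2 hc) hmul (hinf.mono
      fun n hn => ⟨hn.1, hn.2.1, exists_generator_of_pullback_eq_one e hn.2.2⟩)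
  have hI : I = Ideal.span {quadEquiv f s} := by
    have := congrArg (Ideal.map (quadEquiv f).toRingEquiv) hs
    rw [Ideal.map_comap_of_surjective _ (quadEquiv f).toRingEquiv.surjective, Ideal.map_span,
      Set.image_singleton] at this
    exact this
  have hs0 : quadEquiv f s ≠ 0 := by
    intro h0
    rw [hI, h0, Ideal.span_singleton_zero, Ideal.bot_mul, eq_comm,
      Ideal.span_singleton_eq_bot] at hIJ
    exact hc hIJ
  rw [← CommRing.Pic.mk_eq_self (M := L), CommRing.Pic.mk_eq_one_iff]
  exact ⟨e ≪≫ₗ LinearEquiv.ofEq _ _ hI ≪≫ₗ (LinearEquiv.toSpanNonzeroSingleton _ _ _ hs0).symm⟩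

open Filter in
theorem exists_forall_le_eval_neg {f : ℤ[X]} (hm : f.Monic) (hf : Odd f.natDegree) :
    ∃ N : ℤ, ∀ n ≤ N, f.eval n < 0 := by
  have hdeg : 0 < ((f.comp (-X)).map (Int.castRingHom ℝ)).natDegree := by
    rw [natDegree_map_eq_of_injective (Int.castRingHom ℝ).injective_int, natDegree_comp,
      natDegree_neg, natDegree_X, mul_one]
    exact hf.pos
  have hlead : ((f.comp (-X)).map (Int.castRingHom ℝ)).leadingCoeff ≤ 0 := by
    rw [leadingCoeff_map_of_injective (Int.castRingHom ℝ).injective_int,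
      leadingCoeff_comp (by simp), hm.leadingCoeff, leadingCoeff_neg, leadingCoeff_X,
      hf.neg_one_pow]
    simp
  have hlim := tendsto_atBot_of_leadingCoeff_nonpos _ (natDegree_pos_iff_degree_pos.1 hdeg) hlead
  obtain ⟨B, hB⟩ := eventually_atTop.1 (hlim.eventually_lt_atBot 0)
  refine ⟨-⌈B⌉, fun n hn => ?_⟩
  have h := hB ((-n : ℤ) : ℝ) ((Int.le_ceil B).trans (by exact_mod_cast le_neg_of_le_neg hn))
  rw [eval_intCast_map] at h
  simpa using h

theorem infinite_pullback_ne_one {f : ℤ[X]} (hm : f.Monic) (hf : Odd f.natDegree)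
    {L : CommRing.Pic (CoordRing f)} (hL : L ≠ 1) (N : ℤ) :
    {n : ℤ | n ≤ N ∧ n < 0 ∧ f.eval n < 0 ∧ pullback f n L ≠ 1}.Infinite := by
  intro hfin
  obtain ⟨N', hN'⟩ := exists_forall_le_eval_neg hm hf
  refine hL (eq_one_of_infinite_pullback_eq_one hm hf
    (((Set.Iic_infinite (min N (min N' (-1)))).sdiff hfin).mono fun n hn => ?_))
  obtain ⟨hn1, hn2⟩ := hn
  simp only [Set.mem_Iic, le_min_iff] at hn1
  have h0 : n < 0 := by omega
  refine ⟨h0, hN' n hn1.2.1, ?_⟩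
  by_contra h
  exact hn2 ⟨hn1.1, h0, hN' n hn1.2.1, h⟩

end Hyperelliptic

theorem theorem1 (g : ℕ) (hg : 1 ≤ g) (f : Polynomial ℤ) (hmonic : f.Monic)
    (hsqf : Squarefree f) (hdeg : f.natDegree = 2 * g + 1)
    (L : CommRing.Pic (Hyperelliptic.CoordRing f)) :
    (L ≠ 1 → {n : ℤ | n < 0 ∧ f.eval n < 0 ∧ Hyperelliptic.pullback f n L ≠ 1}.Infinite) ∧
    (¬ IsOfFinOrder L → ∀ (B : ℕ) (N : ℤ), ∃ n : ℤ, n ≤ N ∧ n < 0 ∧ f.eval n < 0 ∧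
      IsOfFinOrder (Hyperelliptic.pullback f n L) ∧
      B < orderOf (Hyperelliptic.pullback f n L)) := by
  have hf : Odd f.natDegree := ⟨g, hdeg⟩
  refine ⟨fun hL => ?_, fun hL B N => ?_⟩
  · exact (Hyperelliptic.infinite_pullback_ne_one hmonic hf hL 0).mono fun n hn => hn.2
  -- Every order at most `B` divides `B!`, so a nontrivial pullback of `L ^ B!` forces an order
  -- above `B`.
  · have hpow : L ^ B.factorial ≠ 1 := fun h =>
      hL (isOfFinOrder_iff_pow_eq_one.2 ⟨_, B.factorial_pos, h⟩)
    obtain ⟨n, hn, hn0, hfn, hne⟩ :=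
      (Hyperelliptic.infinite_pullback_ne_one hmonic hf hpow N).nonempty
    have := Hyperelliptic.finite_pic_zsqrtd hfn
    have hfin : IsOfFinOrder (Hyperelliptic.pullback f n L) := isOfFinOrder_of_finite _
    refine ⟨n, hn, hn0, hfn, hfin, ?_⟩
    by_contra! hle
    rw [map_pow] at hne
    exact hne (orderOf_dvd_iff_pow_eq_one.1 (Nat.dvd_factorial hfin.orderOf_pos hle))
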